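/- Let $n\ge 1$, let $\mathbb S^n\subset\mathbb R^{n+1}$ be the unit sphere centred at the origin, with its standard metric $e=(e_{ij})$, and let $R\subset\mathbb R^{n+1}$ be a closed hypersurface that is a radial graph over the whole sphere: $R=\{r(x)=\rho(x)\,x : x\in\mathbb S^n\}$ with $\rho:\mathbb S^n\to(0,\infty)$ of class $C^2$. Let $N$ be the unit normal field of $R$ (as a function of $x$; the choice of sign is irrelevant), let $\gamma(x)=x-2\langle x,N(x)\rangle N(x)$ be the reflector map, and let $\kappa_{ij}=-\langle \partial_i r,\partial_j\gamma\rangle/\rho$ be the intensity form, where the partial derivatives are taken in local coordinates on $\mathbb S^n$. The principal intensities of $R$ at $x$ are the roots $\lambda_1,\dots,\lambda_n$, counted with multiplicity, of $\det(a^i_j-\lambda\delta^i_j)=0$, where $a^i_j=e^{is}\kappa_{sj}$ and $[e^{ij}]=[e_{ij}]^{-1}$, and $S_1=\lambda_1+\dots+\lambda_n$. Then there is a point of $\mathbb S^n$ where $S_1\ge n$, and there is a point of $\mathbb S^n$ where $S_1\le n$. Moreover, $S_1\equiv n$ on $\mathbb S^n$ if and only if $R$ is a sphere of some radius $c>0$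 centred at the origin. -/

import Mathlib

open scoped Manifold ContDiff

noncomputable section

namespace Reflector

/-- Euclidean space `ℝⁿ⁺¹`. -/
abbrev E (n : ℕ) : Type := EuclideanSpace ℝ (Fin (n + 1))

/-- The unit sphere `𝕊ⁿ` centred at the origin of `ℝⁿ⁺¹`. -/
abbrev Sph (n : ℕ) : Type := Metric.sphere (0 : E n) 1

/-- The position vector field `r(x) = ρ(x) x` of the radial graph of `ρ`. -/
def position {n : ℕ} (ρ : Sph n → ℝ) (x : Sph n) : E n := ρ x • (x : E n)

/-- `R` is a closed hypersurface of class `ℳⁿ(𝕊ⁿ)` with radial function `ρ`: the function `ρ` is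
positive and of class `C²` on all of `𝕊ⁿ`, and `R` is its radial graph. -/
structure IsRadialGraph {n : ℕ} (ρ : Sph n → ℝ) (R : Set (E n)) : Prop where
  contMDiff : ContMDiff (𝓡 n) 𝓘(ℝ, ℝ) 2 ρ
  pos : ∀ x, 0 < ρ x
  eq_range : R = Set.range (position ρ)

/-- The differential at `x` of an `ℝⁿ⁺¹`-valued map on the sphere. -/
def diff {n : ℕ} (f : Sph n → E n) (x : Sph n) : TangentSpace (𝓡 n) x →L[ℝ] E n :=
  mvfderiv (𝓡 n) f x

/-- The `i`-th coordinate vector `∂ᵢ` at `x`, for the local coordinates of the sphere given by its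
preferred chart at `x`. -/
def coordVec {n : ℕ} (x : Sph n) (i : Fin n) : TangentSpace (𝓡 n) x :=
  (EuclideanSpace.single i (1 : ℝ) : EuclideanSpace ℝ (Fin n))

/-- The partial derivative `∂ᵢ f` at `x` of an `ℝⁿ⁺¹`-valued map on the sphere. -/
def partialDeriv {n : ℕ} (f : Sph n → E n) (x : Sph n) (i : Fin n) : E n :=
  diff f x (coordVec x i)

/-- The coefficients `eᵢⱼ = ⟨xᵢ, xⱼ⟩` of the standard metric of the sphere. -/
def metric {n : ℕ} (x : Sph n) : Matrix (Fin n) (Fin n) ℝ :=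
  Matrix.of fun i j =>
    inner ℝ (partialDeriv (fun y : Sph n => (y : E n)) x i)
      (partialDeriv (fun y : Sph n => (y : E n)) x j)

/-- The tangent hyperplane (through the origin) at the point `r(x)` of the radial graph
of `ρ`. -/
def tangentHyperplane {n : ℕ} (ρ : Sph n → ℝ) (x : Sph n) : Submodule ℝ (E n) :=
  LinearMap.range (diff (position ρ) x).toLinearMap

/-- The component of `x` orthogonal to the tangent hyperplane at `r(x)`. -/
def normalPart {n : ℕ} (ρ : Sph n → ℝ) (x : Sph n) : E n :=
  (tangentHyperplane ρ x)ᗮ.starProjection (x : E n)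

/-- The outward (`⟨x, N(x)⟩ > 0`) unit normal field `N` of the radial graph of `ρ`, obtained by
normalizing `normalPart`, which does not vanish because the radial direction `x` is transversal
to the graph. -/
def unitNormal {n : ℕ} (ρ : Sph n → ℝ) (x : Sph n) : E n :=
  ‖normalPart ρ x‖⁻¹ • normalPart ρ x

/-- The reflector map `γ(x) = x - 2 ⟨x, N(x)⟩ N(x)`. -/
def reflectorMap {n : ℕ} (ρ : Sph n → ℝ) (x : Sph n) : E n :=
  (x : E n) - (2 * inner ℝ (x : E n) (unitNormal ρ x)) • unitNormal ρ x

/-- The coefficients `κᵢⱼ = -⟨rᵢ, γⱼ⟩ / ρ` of the intensity form. -/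
def intensityForm {n : ℕ} (ρ : Sph n → ℝ) (x : Sph n) : Matrix (Fin n) (Fin n) ℝ :=
  Matrix.of fun i j =>
    -(inner ℝ (partialDeriv (position ρ) x i) (partialDeriv (reflectorMap ρ) x j)) / ρ x

/-- The principal intensities at `x`: the real roots, with multiplicity, of the characteristic
polynomial of the matrix `aⁱⱼ = eⁱˢ κₛⱼ`. -/
def principalIntensities {n : ℕ} (ρ : Sph n → ℝ) (x : Sph n) : Multiset ℝ :=
  ((metric x)⁻¹ * intensityForm ρ x).charpoly.roots

/-- The `m`-th intensity function `S_m`, the `m`-th elementary symmetric function of the principal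
intensities. -/
def S {n : ℕ} (m : ℕ) (ρ : Sph n → ℝ) (x : Sph n) : ℝ :=
  (principalIntensities ρ x).esymm m

end Reflector

end

/-!
Put `u = log ρ`, extended to `ℝⁿ⁺¹ \ {0}` as a function of the direction only (`radialLog`), so that
every differential on the sphere is an ordinary Fréchet derivative composed with that of the
inclusion (`diff_comp_coe`). The normal is proportional to `x - ∇u`, hence
`γ = x - 2 (1 + |∇u|²)⁻¹ (x - ∇u)` (`reflectorMap_eq`), and the intensity form is
`κ = -e + 2 (1 + |∇u|²)⁻¹ (e - ∇²u + du ⊗ du)` (`intensityForm_eq`). It is symmetric, so the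
characteristic polynomial has `n` real roots and `S₁` is a genuine trace (`S_one_eq_sum`):
`S₁ = n + 2 ((1 - n) |∇u|² - Δu) / (1 + |∇u|²)` (`S_one_eq`).

At a maximum of `ρ` we have `∇u = 0` and `Δu ≤ 0`, so `S₁ ≥ n`; at a minimum `S₁ ≤ n`. If `S₁ ≡ n`,
then `Δu = (1 - n) |∇u|² ≤ 0`, so `u` is superharmonic on a closed connected manifold and must be
constant. The strong maximum principle needed here (`le_of_sphereLaplacian_nonpos`) follows from the
second-derivative test alone: given a point `p` and a cap around it, the function
`e^{α ⟪p, x⟫}` with `α` large is strictly subharmonic off the cap, so subtracting a small multiple of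
it from `u` leaves a function whose minimum lies in the cap.
-/

open scoped RealInnerProductSpace Matrix Gradient
open Filter Topology

namespace Reflector

/-! ### Orthonormal frames of the tangent spaces of the sphere -/

/-- An orthonormal basis of the tangent space `x^⊥` of the sphere at `x`, as vectors of `ℝⁿ⁺¹`. -/
noncomputable def tangentFrame {n : ℕ} (x : Sph n) (i : Fin n) : E n :=
  haveI := Fact.mk (@finrank_euclideanSpace_fin ℝ _ (n + 1))
  (OrthonormalBasis.fromOrthogonalSpanSingleton (𝕜 := ℝ) n (ne_zero_of_mem_unit_sphere x) i : E n)

lemma norm_coe_sphere {n : ℕ} (x : Sph n) : ‖(x : E n)‖ = 1 := norm_eq_of_mem_sphere x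

lemma inner_coe_self {n : ℕ} (x : Sph n) : ⟪(x : E n), (x : E n)⟫ = 1 := by
  rw [real_inner_self_eq_norm_sq, norm_coe_sphere, one_pow]

lemma inner_coe_tangentFrame {n : ℕ} (x : Sph n) (i : Fin n) :
    ⟪(x : E n), tangentFrame x i⟫ = 0 := by
  unfold tangentFrame
  exact Submodule.mem_orthogonal_singleton_iff_inner_right.1 (Subtype.property _)

lemma inner_tangentFrame {n : ℕ} (x : Sph n) (i j : Fin n) :
    ⟪tangentFrame x i, tangentFrame x j⟫ = if i = j then (1 : ℝ) else 0 := by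
  unfold tangentFrame
  rw [← Submodule.coe_inner]
  exact orthonormal_iff_ite.1 (OrthonormalBasis.orthonormal _) i j

lemma sum_inner_smul_tangentFrame {n : ℕ} (x : Sph n) {v : E n} (hv : ⟪(x : E n), v⟫ = 0) :
    ∑ i, ⟪tangentFrame x i, v⟫ • tangentFrame x i = v := by
  have := Fact.mk (@finrank_euclideanSpace_fin ℝ _ (n + 1))
  have h := (OrthonormalBasis.fromOrthogonalSpanSingleton (𝕜 := ℝ) n
    (ne_zero_of_mem_unit_sphere x)).sum_repr'
      ⟨v, Submodule.mem_orthogonal_singleton_iff_inner_right.2 hv⟩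
  simpa [tangentFrame] using congrArg Subtype.val h

lemma sum_inner_tangentFrame_sq {n : ℕ} (x : Sph n) (v : E n) :
    ∑ i, ⟪tangentFrame x i, v⟫ ^ 2 = ‖v‖ ^ 2 - ⟪(x : E n), v⟫ ^ 2 := by
  set q : E n := v - ⟪(x : E n), v⟫ • (x : E n) with hq
  have hxq : ⟪(x : E n), q⟫ = 0 := by
    rw [hq, inner_sub_right, real_inner_smul_right, inner_coe_self]; ring
  have hvq : ⟪q, v⟫ = ‖v‖ ^ 2 - ⟪(x : E n), v⟫ ^ 2 := by
    rw [hq, inner_sub_left, real_inner_smul_left, real_inner_self_eq_norm_sq]; ring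
  have hi : ∀ i, ⟪tangentFrame x i, q⟫ = ⟪tangentFrame x i, v⟫ := fun i => by
    rw [hq, inner_sub_right, real_inner_smul_right, real_inner_comm (x : E n) (tangentFrame x i),
      inner_coe_tangentFrame]
    ring
  rw [← hvq]
  conv_rhs => rw [← sum_inner_smul_tangentFrame x hxq]
  rw [sum_inner]
  exact Finset.sum_congr rfl fun i _ => by rw [real_inner_smul_left, hi, sq]

/-! ### The spherical Laplacian and the maximum principle -/

/-- The Laplacian on the unit sphere of the restriction of `F : ℝⁿ⁺¹ → ℝ`, at `x`: the sum over an
orthonormal tangent frame `eᵢ` of the second derivatives of `F` along the great circles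
`cos t • x + sin t • eᵢ`. -/
noncomputable def sphereLaplacian {n : ℕ} (F : E n → ℝ) (x : Sph n) : ℝ :=
  ∑ i, (fderiv ℝ (fderiv ℝ F) x (tangentFrame x i) (tangentFrame x i) - fderiv ℝ F x x)

/-- The second-order necessary condition at a local minimum on the line. -/
lemma deriv_deriv_nonneg_of_isLocalMin {f : ℝ → ℝ} {a : ℝ} (hf : IsLocalMin f a)
    (hc : ContinuousAt f a) : 0 ≤ deriv (deriv f) a := by
  by_contra! h
  have hmax := isLocalMax_of_deriv_deriv_neg h hf.deriv_eq_zero hc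
  -- A point that is both a local minimum and a local maximum has a neighbourhood on which
  -- `f` is constant.
  have hconst : f =ᶠ[𝓝 a] fun _ => f a := by
    filter_upwards [hf, hmax] with t h1 h2 using le_antisymm h2 h1
  have h2 := hconst.deriv.deriv.eq_of_nhds
  simp at h2
  linarith

/-- First and second derivatives along the great circle through `x` with velocity `e`. -/
lemma greatCircle_derivs {n : ℕ} {F : E n → ℝ} {x e : E n} (hF : ContDiffAt ℝ 2 F x) :
    HasDerivAt (fun t : ℝ => F (Real.cos t • x + Real.sin t • e)) (fderiv ℝ F x e) 0 ∧
    deriv (deriv fun t : ℝ => F (Real.cos t • x + Real.sin t • e)) 0 =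
      fderiv ℝ (fderiv ℝ F) x e e - fderiv ℝ F x x := by
  set c : ℝ → E n := fun t => Real.cos t • x + Real.sin t • e with hc
  have hc0 : c 0 = x := by simp [hc]
  have hcd : ∀ t, HasDerivAt c (-Real.sin t • x + Real.cos t • e) t := fun t =>
    ((Real.hasDerivAt_cos t).smul_const x).add ((Real.hasDerivAt_sin t).smul_const e)
  have hcd2 : HasDerivAt (fun t => -Real.sin t • x + Real.cos t • e) (-x) 0 := by
    have h := ((Real.hasDerivAt_sin 0).neg.smul_const x).add
      ((Real.hasDerivAt_cos 0).smul_const e)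
    rwa [show -Real.cos 0 • x + -Real.sin 0 • e = -x by simp] at h
  have hev : ∀ᶠ t in 𝓝 (0 : ℝ), DifferentiableAt ℝ F (c t) := by
    have h1 : ∀ᶠ y in 𝓝 (c 0), DifferentiableAt ℝ F y := by
      rw [hc0]
      filter_upwards [hF.eventually (by simp)] with y hy using hy.differentiableAt (by simp)
    exact (hcd 0).continuousAt.eventually h1
  have hd : ∀ᶠ t in 𝓝 (0 : ℝ), HasDerivAt (fun t => F (c t))
      (fderiv ℝ F (c t) (-Real.sin t • x + Real.cos t • e)) t := by
    filter_upwards [hev] with t ht using ht.hasFDerivAt.comp_hasDerivAt t (hcd t)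
  refine ⟨by simpa [hc0] using hd.self_of_nhds, ?_⟩
  have hdd : deriv (fun t => F (c t)) =ᶠ[𝓝 0]
      fun t => fderiv ℝ F (c t) (-Real.sin t • x + Real.cos t • e) := by
    filter_upwards [hd] with t ht using ht.deriv
  rw [hdd.deriv_eq]
  have hF2 : HasFDerivAt (fderiv ℝ F) (fderiv ℝ (fderiv ℝ F) x) (c 0) := by
    rw [hc0]
    exact ((hF.fderiv_right (m := 1) (by norm_num)).differentiableAt (by simp)).hasFDerivAt
  have h3 := ((hF2.comp_hasDerivAt 0 (hcd 0)).clm_apply hcd2).deriv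
  simp only [Function.comp_def] at h3
  rw [h3]
  simp [hc0, sub_eq_add_neg]

/-- At a minimum on the sphere, the tangential gradient vanishes and the spherical Laplacian is
nonnegative. -/
lemma sphereLaplacian_nonneg_of_min {n : ℕ} {F : E n → ℝ} {x : Sph n}
    (hF : ContDiffAt ℝ 2 F (x : E n)) (hmin : ∀ y : Sph n, F x ≤ F y) :
    (∀ i, fderiv ℝ F x (tangentFrame x i) = 0) ∧ 0 ≤ sphereLaplacian F x := by
  have key : ∀ i, fderiv ℝ F x (tangentFrame x i) = 0 ∧
      0 ≤ fderiv ℝ (fderiv ℝ F) x (tangentFrame x i) (tangentFrame x i) - fderiv ℝ F x x := by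
    intro i
    obtain ⟨h1, h2⟩ := greatCircle_derivs (e := tangentFrame x i) hF
    have hloc : IsLocalMin
        (fun t : ℝ => F (Real.cos t • (x : E n) + Real.sin t • tangentFrame x i)) 0 := by
      refine Eventually.of_forall fun t => ?_
      have hs : Real.cos t • (x : E n) + Real.sin t • tangentFrame x i ∈
          Metric.sphere (0 : E n) 1 := by
        rw [mem_sphere_zero_iff_norm, ← sq_eq_sq₀ (norm_nonneg _) zero_le_one,
          ← real_inner_self_eq_norm_sq]
        simp only [inner_add_left, inner_add_right, real_inner_smul_left, real_inner_smul_right,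
          inner_coe_self, inner_coe_tangentFrame, inner_tangentFrame,
          real_inner_comm (x : E n) (tangentFrame x i)]
        simp only [if_true]
        linear_combination Real.sin_sq_add_cos_sq t
      simpa using hmin ⟨_, hs⟩
    exact ⟨hloc.hasDerivAt_eq_zero h1,
      h2 ▸ deriv_deriv_nonneg_of_isLocalMin hloc h1.continuousAt⟩
  exact ⟨fun i => (key i).1, Finset.sum_nonneg fun i _ => (key i).2⟩

lemma sphereLaplacian_sub {n : ℕ} {F G : E n → ℝ} {x : Sph n}
    (hF : ContDiffAt ℝ 2 F (x : E n)) (hG : ContDiffAt ℝ 2 G (x : E n)) :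
    sphereLaplacian (F - G) x = sphereLaplacian F x - sphereLaplacian G x := by
  have hev : fderiv ℝ (F - G) =ᶠ[𝓝 (x : E n)] fderiv ℝ F - fderiv ℝ G := by
    filter_upwards [hF.eventually (by simp), hG.eventually (by simp)] with y h1 h2
    exact fderiv_sub (h1.differentiableAt (by simp)) (h2.differentiableAt (by simp))
  have h2 : fderiv ℝ (fderiv ℝ (F - G)) x =
      fderiv ℝ (fderiv ℝ F) x - fderiv ℝ (fderiv ℝ G) x := by
    rw [hev.fderiv_eq]
    exact fderiv_sub ((hF.fderiv_right (m := 1) (by norm_num)).differentiableAt (by simp))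
      ((hG.fderiv_right (m := 1) (by norm_num)).differentiableAt (by simp))
  unfold sphereLaplacian
  rw [h2, hev.eq_of_nhds, ← Finset.sum_sub_distrib]
  refine Finset.sum_congr rfl fun i _ => ?_
  simp only [Pi.sub_apply, _root_.sub_apply]
  ring

lemma hasFDerivAt_exp_inner {n : ℕ} (c α : ℝ) (p y : E n) :
    HasFDerivAt (fun y : E n => c * Real.exp (α * ⟪p, y⟫))
      ((c * α * Real.exp (α * ⟪p, y⟫)) • innerSL ℝ p) y := by
  have h := ((((innerSL ℝ p).hasFDerivAt (x := y)).const_mul α).exp).const_mul c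
  simp only [innerSL_apply_apply] at h
  refine h.congr_fderiv ?_
  rw [smul_smul, smul_smul]
  congr 1
  ring

/-- The spherical Laplacian of a zonal exponential, `Δ e^{α t} = (α² (1 - t²) - n α t) e^{α t}` with
`t = ⟪p, x⟫`. -/
lemma sphereLaplacian_exp_inner {n : ℕ} (c α : ℝ) (p x : Sph n) :
    sphereLaplacian (fun y : E n => c * Real.exp (α * ⟪(p : E n), y⟫)) x =
      c * α * Real.exp (α * ⟪(p : E n), (x : E n)⟫) *
        (α * (1 - ⟪(p : E n), (x : E n)⟫ ^ 2) - n * ⟪(p : E n), (x : E n)⟫) := by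
  have h1 : fderiv ℝ (fun y : E n => c * Real.exp (α * ⟪(p : E n), y⟫)) =
      fun y => (c * α * Real.exp (α * ⟪(p : E n), y⟫)) • innerSL ℝ (p : E n) :=
    funext fun y => (hasFDerivAt_exp_inner c α (p : E n) y).fderiv
  unfold sphereLaplacian
  rw [h1, ((hasFDerivAt_exp_inner (c * α) α (p : E n) (x : E n)).smul_const
    (innerSL ℝ (p : E n))).fderiv]
  have h2 := sum_inner_tangentFrame_sq x (p : E n)
  rw [norm_coe_sphere, real_inner_comm] at h2
  simp only [ContinuousLinearMap.smulRight_apply, _root_.smul_apply,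
    innerSL_apply_apply, smul_eq_mul, Finset.sum_sub_distrib, Finset.sum_const, Finset.card_univ,
    Fintype.card_fin, nsmul_eq_mul]
  have h3 : ∀ i, c * α * α * Real.exp (α * ⟪(p : E n), (x : E n)⟫) *
      ⟪(p : E n), tangentFrame x i⟫ * ⟪(p : E n), tangentFrame x i⟫ =
      c * α * α * Real.exp (α * ⟪(p : E n), (x : E n)⟫) * ⟪tangentFrame x i, (p : E n)⟫ ^ 2 := by
    intro i
    rw [real_inner_comm (p : E n)]; ring
  rw [Finset.sum_congr rfl fun i _ => h3 i, ← Finset.mul_sum, h2]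
  ring

/-- Away from a cap around its pole, a steep enough zonal exponential is strictly subharmonic. -/
lemma zonal_pos {n : ℕ} (hn : 1 ≤ n) {δ t : ℝ} (hδ : 0 < δ) (ht : -1 ≤ t) (htδ : t ≤ 1 - δ) :
    0 < (n + 1) / δ * (1 - t ^ 2) - n * t := by
  have hn' : (1 : ℝ) ≤ n := by exact_mod_cast hn
  have hα : 0 < ((n : ℝ) + 1) / δ := by positivity
  rcases lt_trichotomy t 0 with h | h | h
  · have : 0 ≤ 1 - t ^ 2 := by nlinarith
    nlinarith [mul_nonneg hα.le this]
  · subst h; simpa using hα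
  · have h1 : δ ≤ 1 - t ^ 2 := by nlinarith
    have h2 : ((n : ℝ) + 1) ≤ (n + 1) / δ * (1 - t ^ 2) := by
      calc ((n : ℝ) + 1) = (n + 1) / δ * δ := by field_simp
        _ ≤ _ := by gcongr
    nlinarith

/-- The strong maximum principle on the sphere: a superharmonic function is constant. Subtracting a
small multiple of a zonal function that is strictly subharmonic off a cap around `p` pushes
the minimum into that cap; hence every `p` is a minimum point. -/
lemma le_of_sphereLaplacian_nonpos {n : ℕ} (hn : 1 ≤ n) {F : E n → ℝ}
    (hF : ∀ x : Sph n, ContDiffAt ℝ 2 F (x : E n)) (hΔ : ∀ x, sphereLaplacian F x ≤ 0)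
    (p y : Sph n) : F p ≤ F y := by
  by_contra! hlt
  set η := (F p - F y) / 2 with hη
  have hηpos : 0 < η := by rw [hη]; linarith
  obtain ⟨r, hr, hball⟩ := Metric.eventually_nhds_iff.1
    ((hF p).continuousAt.eventually (lt_mem_nhds (show F y + η < F p by rw [hη]; linarith)))
  -- On the sphere, `r ≤ ‖z - p‖` means `⟪p, z⟫ ≤ 1 - δ`.
  set δ := r ^ 2 / 2 with hδ
  have hδpos : 0 < δ := by positivity
  set α : ℝ := (n + 1) / δ with hα
  have hαpos : 0 < α := by positivity
  -- The coefficient is chosen so that `0 < φ ≤ η` on the sphere.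
  set φ : E n → ℝ := fun z => (η * Real.exp (-α)) * Real.exp (α * ⟪(p : E n), z⟫) with hφ
  have hφC : ∀ z : E n, ContDiffAt ℝ 2 φ z := fun z =>
    (contDiff_const.mul ((contDiff_const.mul (contDiff_const.inner ℝ contDiff_id)).exp)).contDiffAt
  have hcont : Continuous fun z : Sph n => (F - φ) z := by
    rw [continuous_iff_continuousAt]
    intro z
    exact ((hF z).sub (hφC z)).continuousAt.comp continuous_subtype_val.continuousAt
  have : Nonempty (Sph n) := ⟨p⟩
  obtain ⟨z, hz⟩ := hcont.exists_forall_le_of_hasCompactSupport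
    (HasCompactSupport.of_compactSpace _)
  have ht1 : |⟪(p : E n), (z : E n)⟫| ≤ 1 := by
    simpa [norm_coe_sphere] using abs_real_inner_le_norm (p : E n) (z : E n)
  obtain ⟨ht1, ht2⟩ := abs_le.1 ht1
  have hφz : φ z ≤ η := by
    have : Real.exp (-α) * Real.exp (α * ⟪(p : E n), (z : E n)⟫) ≤ 1 := by
      rw [← Real.exp_add]
      exact Real.exp_le_one_iff.2 (by nlinarith)
    simp only [hφ, mul_assoc]
    nlinarith
  have hφy : 0 < φ y := by simp only [hφ]; positivity
  by_cases hcap : dist (z : E n) (p : E n) < r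
  · have h1 := hball hcap
    have h2 := hz y
    simp only [Pi.sub_apply] at h2
    linarith
  · have hdist : r ^ 2 ≤ 2 - 2 * ⟪(p : E n), (z : E n)⟫ := by
      have h1 : r ≤ ‖(z : E n) - p‖ := by rw [← dist_eq_norm]; exact not_lt.1 hcap
      have h2 := norm_sub_sq_real (z : E n) (p : E n)
      rw [norm_coe_sphere, norm_coe_sphere, real_inner_comm] at h2
      nlinarith
    have hpos := zonal_pos hn hδpos ht1 (show ⟪(p : E n), (z : E n)⟫ ≤ 1 - δ by rw [hδ]; linarith)
    have h1 : 0 ≤ sphereLaplacian (F - φ) z :=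
      (sphereLaplacian_nonneg_of_min ((hF z).sub (hφC z)) hz).2
    rw [sphereLaplacian_sub (hF z) (hφC z), hφ, sphereLaplacian_exp_inner] at h1
    have h2 : 0 < η * Real.exp (-α) * α * Real.exp (α * ⟪(p : E n), (z : E n)⟫) *
        (α * (1 - ⟪(p : E n), (z : E n)⟫ ^ 2) - n * ⟪(p : E n), (z : E n)⟫) := by positivity
    linarith [hΔ z]

/-! ### The logarithm of the radial function as a homogeneous function -/

/-- The extension of `log ρ` to a function on `ℝⁿ⁺¹ \ {0}` that is positively homogeneous of
degree `0`; its value at the origin is irrelevant. -/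
noncomputable def radialLog {n : ℕ} (ρ : Sph n → ℝ) (y : E n) : ℝ :=
  open Classical in
  if h : y ≠ 0 then
    Real.log (ρ ⟨‖y‖⁻¹ • y, by simp [norm_smul, h]⟩)
  else 0

lemma radialLog_coe {n : ℕ} (ρ : Sph n → ℝ) (x : Sph n) : radialLog ρ x = Real.log (ρ x) := by
  unfold radialLog
  rw [dif_pos (ne_zero_of_mem_unit_sphere x)]
  congr 2
  ext1
  simp

lemma radialLog_smul {n : ℕ} (ρ : Sph n → ℝ) {t : ℝ} (ht : 0 < t) (y : E n) :
    radialLog ρ (t • y) = radialLog ρ y := by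
  unfold radialLog
  by_cases h : y = 0
  · simp [h]
  · rw [dif_pos h, dif_pos (smul_ne_zero ht.ne' h)]
    congr 2
    ext1
    simp only [norm_smul, Real.norm_eq_abs, abs_of_pos ht, smul_smul]
    congr 1
    field_simp

lemma contDiffAt_radialLog {n : ℕ} {ρ : Sph n → ℝ} (hρ : ContMDiff (𝓡 n) 𝓘(ℝ, ℝ) 2 ρ)
    (hpos : ∀ x, 0 < ρ x) {y : E n} (hy : y ≠ 0) : ContDiffAt ℝ 2 (radialLog ρ) y := by
  have := Fact.mk (@finrank_euclideanSpace_fin ℝ _ (n + 1))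
  let V : TopologicalSpace.Opens (E n) := ⟨{0}ᶜ, isOpen_compl_singleton⟩
  have hmem : ∀ z : V, (fun z : V => ‖(z : E n)‖⁻¹ • (z : E n)) z ∈ Metric.sphere (0 : E n) 1 :=
    fun z => by
      have hz : (z : E n) ≠ 0 := z.2
      simp [norm_smul, hz]
  have h1 : ContMDiff 𝓘(ℝ, E n) 𝓘(ℝ, E n) 2 fun z : V => ‖(z : E n)‖⁻¹ • (z : E n) := by
    intro z
    have hz : (z : E n) ≠ 0 := z.2
    refine (contMDiffAt_subtype_iff (f := fun z : E n => ‖z‖⁻¹ • z)).2 ?_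
    exact (((contDiffAt_norm ℝ hz).inv (norm_ne_zero_iff.2 hz)).smul contDiffAt_id).contMDiffAt
  have h2 : ContMDiff 𝓘(ℝ, E n) 𝓘(ℝ, ℝ) 2 (ρ ∘ Set.codRestrict _ _ hmem) :=
    hρ.comp (h1.codRestrict_sphere hmem)
  have h3 : ContMDiffAt 𝓘(ℝ, E n) 𝓘(ℝ, ℝ) 2 (fun z : V => radialLog ρ z) ⟨y, hy⟩ := by
    have h4 : (fun z : V => radialLog ρ z) = Real.log ∘ (ρ ∘ Set.codRestrict _ _ hmem) := by
      funext z
      exact dif_pos z.2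
    rw [h4]
    exact (Real.contDiffAt_log.2 (hpos _).ne').contMDiffAt.comp (⟨y, hy⟩ : V) (h2 ⟨y, hy⟩)
  exact (contMDiffAt_subtype_iff.1 h3).contDiffAt

/-- Euler's identity for the degree-`0` homogeneous function `radialLog ρ`. -/
lemma fderiv_radialLog_self {n : ℕ} {ρ : Sph n → ℝ} {y : E n}
    (h : DifferentiableAt ℝ (radialLog ρ) y) : fderiv ℝ (radialLog ρ) y y = 0 := by
  have h1 : HasDerivAt (fun t : ℝ => radialLog ρ (t • y)) (fderiv ℝ (radialLog ρ) y y) 1 := by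
    have hs : HasDerivAt (fun t : ℝ => t • y) y 1 := by
      simpa using (hasDerivAt_id (1 : ℝ)).smul_const y
    have hF : HasFDerivAt (radialLog ρ) (fderiv ℝ (radialLog ρ) y) ((1 : ℝ) • y) := by
      rw [one_smul]; exact h.hasFDerivAt
    exact hF.comp_hasDerivAt (1 : ℝ) hs
  have h2 : (fun t : ℝ => radialLog ρ (t • y)) =ᶠ[𝓝 1] fun _ => radialLog ρ y := by
    filter_upwards [lt_mem_nhds zero_lt_one] with t ht using radialLog_smul ρ ht y
  rw [← h1.deriv, h2.deriv_eq, deriv_const]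

/-- Euler's identity, differentiated: the radial component of the Hessian. -/
lemma fderiv_fderiv_radialLog_self {n : ℕ} {ρ : Sph n → ℝ} {y : E n}
    (h : ContDiffAt ℝ 2 (radialLog ρ) y) (w : E n) :
    fderiv ℝ (fderiv ℝ (radialLog ρ)) y w y = -fderiv ℝ (radialLog ρ) y w := by
  have h1 : (fun z => fderiv ℝ (radialLog ρ) z z) =ᶠ[𝓝 y] fun _ => 0 := by
    filter_upwards [h.eventually (by simp)] with z hz
      using fderiv_radialLog_self (hz.differentiableAt (by simp))
  have h2 := ((h.fderiv_right (m := 1)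
    (by norm_num)).differentiableAt (by simp)).hasFDerivAt.clm_apply (hasFDerivAt_id y)
  have h3 := congrArg (fun L : E n →L[ℝ] ℝ => L w) (h2.fderiv.symm.trans h1.fderiv_eq)
  simp at h3
  linarith

/-! ### Differentials of restrictions to the sphere -/

lemma range_diff_coe {n : ℕ} (x : Sph n) :
    (diff (fun y : Sph n => (y : E n)) x).range = (ℝ ∙ (x : E n))ᗮ :=
  have := Fact.mk (@finrank_euclideanSpace_fin ℝ _ (n + 1))
  range_mvfderiv_subtypeVal x

lemma injective_diff_coe {n : ℕ} (x : Sph n) :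
    Function.Injective (diff (fun y : Sph n => (y : E n)) x) :=
  have := Fact.mk (@finrank_euclideanSpace_fin ℝ _ (n + 1))
  injective_mvfderiv_subtypeVal_sphere x

/-- The chain rule for the restriction to the sphere of a map of the ambient space. -/
lemma diff_comp_coe {n : ℕ} {f : Sph n → E n} {F : E n → E n} {F' : E n →L[ℝ] E n} {x : Sph n}
    (hf : ∀ y : Sph n, f y = F y) (hF : HasFDerivAt F F' x) (v : TangentSpace (𝓡 n) x) :
    diff f x v = F' (diff (fun y : Sph n => (y : E n)) x v) := by
  have := Fact.mk (@finrank_euclideanSpace_fin ℝ _ (n + 1))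
  obtain rfl : f = F ∘ fun y : Sph n => (y : E n) := funext hf
  have hc : MDifferentiableAt (𝓡 n) 𝓘(ℝ, E n) (fun y : Sph n => (y : E n)) x :=
    (contMDiff_coe_sphere (m := 1) x).mdifferentiableAt one_ne_zero
  have h := HasMFDerivAt.comp x hF.hasMFDerivAt hc.hasMFDerivAt
  unfold diff mvfderiv
  rw [h.mfderiv]
  rfl

/-! ### The trace of the intensity form -/

/-- If the intensity form is the pullback of a symmetric bilinear form `B` of the ambient space, then
the sum of the principal intensities is the trace of `B` over an orthonormal tangent frame. With `A`
the matrix of the coordinate vectors in that frame and `K` that of `B`, one has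
`(AᵀA)⁻¹ (AᵀKA) = A⁻¹KA`, and all eigenvalues of the symmetric matrix `K` are real. -/
lemma S_one_eq_sum {n : ℕ} {ρ : Sph n → ℝ} {x : Sph n} (B : E n →ₗ[ℝ] E n →ₗ[ℝ] ℝ)
    (hB : ∀ v w, B v w = B w v)
    (hκ : ∀ i j, intensityForm ρ x i j =
      B (partialDeriv (fun y : Sph n => (y : E n)) x i)
        (partialDeriv (fun y : Sph n => (y : E n)) x j)) :
    S 1 ρ x = ∑ i, B (tangentFrame x i) (tangentFrame x i) := by
  set X : Fin n → E n := partialDeriv (fun y : Sph n => (y : E n)) x with hX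
  set A : Matrix (Fin n) (Fin n) ℝ := Matrix.of fun k j => ⟪tangentFrame x k, X j⟫ with hA
  set K : Matrix (Fin n) (Fin n) ℝ :=
    Matrix.of fun k l => B (tangentFrame x k) (tangentFrame x l) with hK
  have hXx : ∀ j, ⟪(x : E n), X j⟫ = 0 := fun j => by
    refine Submodule.mem_orthogonal_singleton_iff_inner_right.1 ?_
    rw [← range_diff_coe]
    exact ⟨_, rfl⟩
  have hXA : ∀ j, X j = ∑ k, A k j • tangentFrame x k := fun j =>
    (sum_inner_smul_tangentFrame x (hXx j)).symm
  have hmetric : metric x = Aᵀ * A := by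
    ext i j
    change ⟪X i, X j⟫ = _
    rw [hXA j, inner_sum, Matrix.mul_apply]
    refine Finset.sum_congr rfl fun k _ => ?_
    rw [real_inner_smul_right, real_inner_comm, Matrix.transpose_apply, mul_comm]
    rfl
  have hint : intensityForm ρ x = Aᵀ * K * A := by
    ext i j
    rw [hκ, hXA i, hXA j]
    simp only [map_sum, map_smul, LinearMap.sum_apply, LinearMap.smul_apply, smul_eq_mul,
      Matrix.mul_apply, Matrix.transpose_apply, Finset.mul_sum, Finset.sum_mul]
    refine Finset.sum_congr rfl fun k _ => Finset.sum_congr rfl fun l _ => ?_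
    simp only [hK, Matrix.of_apply]
    ring
  have hAu : IsUnit A := by
    rw [← Matrix.mulVec_injective_iff_isUnit]
    refine (injective_iff_map_eq_zero A.mulVecLin).2 fun c hc => ?_
    have h0 : diff (fun y : Sph n => (y : E n)) x
        (∑ j, c j • (coordVec x j : TangentSpace (𝓡 n) x)) = 0 := by
      rw [map_sum]
      simp only [map_smul]
      change ∑ j, c j • X j = 0
      simp only [hXA, Finset.smul_sum]
      rw [Finset.sum_comm]
      refine Finset.sum_eq_zero fun k _ => ?_
      simp only [smul_smul]
      rw [← Finset.sum_smul]
      have := congrFun hc k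
      simp only [Matrix.mulVecLin_apply, Matrix.mulVec, dotProduct, Pi.zero_apply] at this
      rw [Finset.sum_congr rfl fun j _ => mul_comm (c j) (A k j), this, zero_smul]
    have h1 := injective_diff_coe x (h0.trans (map_zero _).symm)
    -- By definition, the coordinate vectors are the standard basis of the model space.
    have h2 : ∑ j, c j • (EuclideanSpace.single j (1 : ℝ) : EuclideanSpace ℝ (Fin n)) = 0 := h1
    funext i
    have h3 := congrArg (fun v : EuclideanSpace ℝ (Fin n) => v i) h2
    simpa [Pi.single_apply] using h3
  have hdet : IsUnit A.det := (Matrix.isUnit_iff_isUnit_det A).1 hAu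
  have hmat : (metric x)⁻¹ * intensityForm ρ x = A⁻¹ * K * A := by
    rw [hmetric, hint, Matrix.mul_inv_rev]
    have : (Aᵀ)⁻¹ * Aᵀ = 1 := Matrix.nonsing_inv_mul _ (by rwa [Matrix.det_transpose])
    calc A⁻¹ * (Aᵀ)⁻¹ * (Aᵀ * K * A) = A⁻¹ * ((Aᵀ)⁻¹ * Aᵀ) * K * A := by
          simp only [Matrix.mul_assoc]
      _ = A⁻¹ * K * A := by rw [this, Matrix.mul_one]
  have hchar : ((metric x)⁻¹ * intensityForm ρ x).charpoly = K.charpoly := by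
    rw [hmat, Matrix.charpoly_mul_comm, ← Matrix.mul_assoc, Matrix.mul_nonsing_inv _ hdet,
      Matrix.one_mul]
  have hherm : K.IsHermitian := by
    ext i j
    simp [hK, hB (tangentFrame x i)]
  unfold S principalIntensities
  rw [hchar, Multiset.esymm, Multiset.powersetCard_one, Multiset.map_map]
  simp only [Function.comp_def, Multiset.prod_singleton, Multiset.map_id']
  rw [← Matrix.trace_eq_sum_roots_charpoly_of_splits hherm.splits_charpoly]
  rfl

/-! ### The normal field, the reflector map and the intensity form in terms of `log ρ` -/

lemma inner_coe_gradient {n : ℕ} {ρ : Sph n → ℝ} {x : Sph n}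
    (h : DifferentiableAt ℝ (radialLog ρ) (x : E n)) :
    ⟪∇ (radialLog ρ) (x : E n), (x : E n)⟫ = 0 := by
  rw [inner_gradient_left, fderiv_radialLog_self h]

lemma diff_position {n : ℕ} {ρ : Sph n → ℝ} (hpos : ∀ x, 0 < ρ x) {x : Sph n}
    (h : DifferentiableAt ℝ (radialLog ρ) (x : E n)) (v : TangentSpace (𝓡 n) x) :
    diff (position ρ) x v = ρ x • (diff (fun y : Sph n => (y : E n)) x v +
      ⟪∇ (radialLog ρ) (x : E n), diff (fun y : Sph n => (y : E n)) x v⟫ • (x : E n)) := by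
  have h1 : ∀ y : Sph n, position ρ y = Real.exp (radialLog ρ y) • (y : E n) := fun y => by
    rw [radialLog_coe, Real.exp_log (hpos y), position]
  rw [diff_comp_coe h1 (h.hasFDerivAt.exp.smul (hasFDerivAt_id (x : E n))), inner_gradient_left]
  simp [radialLog_coe, Real.exp_log (hpos x), smul_add, smul_smul]

lemma normalPart_eq {n : ℕ} {ρ : Sph n → ℝ} (hpos : ∀ x, 0 < ρ x) {x : Sph n}
    (h : DifferentiableAt ℝ (radialLog ρ) (x : E n)) :
    normalPart ρ x = (1 + ‖∇ (radialLog ρ) (x : E n)‖ ^ 2)⁻¹ •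
      ((x : E n) - ∇ (radialLog ρ) (x : E n)) := by
  set g := ∇ (radialLog ρ) (x : E n) with hg
  have hgx : ⟪g, (x : E n)⟫ = 0 := inner_coe_gradient h
  have hxg : ⟪(x : E n), g⟫ = 0 := by rw [real_inner_comm]; exact hgx
  have hW : (1 + ‖g‖ ^ 2) ≠ 0 := by positivity
  refine Submodule.eq_starProjection_of_mem_orthogonal ?_ ?_
  · refine Submodule.smul_mem _ _ ((Submodule.mem_orthogonal _ _).2 ?_)
    rintro _ ⟨v, rfl⟩
    have hv : ⟪(x : E n), diff (fun y : Sph n => (y : E n)) x v⟫ = 0 := by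
      refine Submodule.mem_orthogonal_singleton_iff_inner_right.1 ?_
      rw [← range_diff_coe]
      exact ⟨_, rfl⟩
    change ⟪diff (position ρ) x v, _⟫ = 0
    rw [diff_position hpos h, ← hg, real_inner_smul_left, inner_add_left, real_inner_smul_left,
      inner_sub_right, inner_sub_right, inner_coe_self, hxg, real_inner_comm, hv,
      real_inner_comm g]
    ring
  · refine Submodule.le_orthogonal_orthogonal _ ?_
    -- The tangential part of `x` is the image of the multiple `g / (1 + |g|²)` of the gradient.
    have hgr : g ∈ (diff (fun y : Sph n => (y : E n)) x).range := by
      rw [range_diff_coe]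
      exact Submodule.mem_orthogonal_singleton_iff_inner_right.2 hxg
    obtain ⟨v, hv⟩ := hgr
    refine ⟨((ρ x)⁻¹ * (1 + ‖g‖ ^ 2)⁻¹) • v, ?_⟩
    change diff (position ρ) x _ = _
    have hv' : diff (fun y : Sph n => (y : E n)) x v = g := hv
    rw [map_smul, diff_position hpos h, ← hg, hv', real_inner_self_eq_norm_sq, smul_smul,
      mul_comm (ρ x)⁻¹, mul_assoc, inv_mul_cancel₀ (hpos x).ne', mul_one]
    match_scalars <;> field_simp
    ring

lemma reflectorMap_eq {n : ℕ} {ρ : Sph n → ℝ} (hpos : ∀ x, 0 < ρ x) {x : Sph n}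
    (h : DifferentiableAt ℝ (radialLog ρ) (x : E n)) :
    reflectorMap ρ x = (x : E n) - (2 * (1 + ‖∇ (radialLog ρ) (x : E n)‖ ^ 2)⁻¹) •
      ((x : E n) - ∇ (radialLog ρ) (x : E n)) := by
  have hq := normalPart_eq hpos h
  set g := ∇ (radialLog ρ) (x : E n) with hg
  have hgx : ⟪g, (x : E n)⟫ = 0 := inner_coe_gradient h
  have hxg : ⟪(x : E n), g⟫ = 0 := by rw [real_inner_comm]; exact hgx
  have hW : (1 + ‖g‖ ^ 2) ≠ 0 := by positivity
  have h1 : ⟪(x : E n), normalPart ρ x⟫ = (1 + ‖g‖ ^ 2)⁻¹ := by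
    rw [hq, real_inner_smul_right, inner_sub_right, inner_coe_self, hxg, sub_zero, mul_one]
  have h2 : ‖normalPart ρ x‖ ^ 2 = (1 + ‖g‖ ^ 2)⁻¹ := by
    rw [← real_inner_self_eq_norm_sq]
    nth_rw 1 [hq]
    rw [real_inner_smul_left, inner_sub_left, h1, hq, real_inner_smul_right, inner_sub_right,
      hgx, real_inner_self_eq_norm_sq]
    field_simp
    ring
  have h3 : ‖normalPart ρ x‖ ≠ 0 := fun h0 => by
    rw [h0] at h2
    exact inv_ne_zero hW (by rw [← h2]; simp)
  unfold reflectorMap unitNormal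
  rw [real_inner_smul_right, smul_smul, h1, ← h2, show 2 * (‖normalPart ρ x‖⁻¹ *
    ‖normalPart ρ x‖ ^ 2) * ‖normalPart ρ x‖⁻¹ = 2 by field_simp, h2, hq, smul_smul]

/-- The intensity form as a bilinear form of the ambient space, `-⟪v, w⟫ + 2 (1 + |∇u|²)⁻¹
(⟪v, w⟫ - D²u(v, w) + ⟪∇u, v⟫⟪∇u, w⟫)` with `u = log ρ`. -/
noncomputable def intensityBilin {n : ℕ} (ρ : Sph n → ℝ) (x : Sph n) :
    E n →ₗ[ℝ] E n →ₗ[ℝ] ℝ :=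
  LinearMap.mk₂ ℝ (fun v w => -⟪v, w⟫ + 2 * (1 + ‖∇ (radialLog ρ) (x : E n)‖ ^ 2)⁻¹ *
      (⟪v, w⟫ - fderiv ℝ (fderiv ℝ (radialLog ρ)) x v w +
        fderiv ℝ (radialLog ρ) x v * fderiv ℝ (radialLog ρ) x w))
    (fun v v' w => by simp only [inner_add_left, map_add, _root_.add_apply]; ring)
    (fun c v w => by
      simp only [real_inner_smul_left, map_smul, _root_.smul_apply, smul_eq_mul]; ring)
    (fun v w w' => by simp only [inner_add_right, map_add]; ring)
    (fun c v w => by simp only [real_inner_smul_right, map_smul, smul_eq_mul]; ring)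

lemma intensityBilin_symm {n : ℕ} {ρ : Sph n → ℝ} {x : Sph n}
    (h : ContDiffAt ℝ 2 (radialLog ρ) (x : E n)) (v w : E n) :
    intensityBilin ρ x v w = intensityBilin ρ x w v := by
  simp only [intensityBilin, LinearMap.mk₂_apply]
  rw [real_inner_comm, (h.isSymmSndFDerivAt (by simp)).eq v w]
  ring

/-- The gradient is differentiable, its derivative being the Hessian operator. -/
lemma hasFDerivAt_gradient {n : ℕ} {F : E n → ℝ} {y : E n} (h : ContDiffAt ℝ 2 F y) :
    ∃ H : E n →L[ℝ] E n, HasFDerivAt (∇ F) H y ∧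
      ∀ w v, ⟪H w, v⟫ = fderiv ℝ (fderiv ℝ F) y w v := by
  let D : StrongDual ℝ (E n) →L[ℝ] E n :=
    { toFun := (InnerProductSpace.toDual ℝ (E n)).symm
      map_add' := map_add _
      map_smul' := fun c l => by simp
      cont := (InnerProductSpace.toDual ℝ (E n)).symm.continuous }
  refine ⟨D ∘L fderiv ℝ (fderiv ℝ F) y, D.hasFDerivAt.comp y
    ((h.fderiv_right (m := 1) (by norm_num)).differentiableAt (by simp)).hasFDerivAt,
    fun w v => ?_⟩
  exact InnerProductSpace.toDual_symm_apply

lemma intensityForm_eq {n : ℕ} {ρ : Sph n → ℝ} (hρ : ContMDiff (𝓡 n) 𝓘(ℝ, ℝ) 2 ρ)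
    (hpos : ∀ x, 0 < ρ x) (x : Sph n) (i j : Fin n) :
    intensityForm ρ x i j =
      intensityBilin ρ x (partialDeriv (fun y : Sph n => (y : E n)) x i)
        (partialDeriv (fun y : Sph n => (y : E n)) x j) := by
  have hC : ∀ y : Sph n, ContDiffAt ℝ 2 (radialLog ρ) (y : E n) := fun y =>
    contDiffAt_radialLog hρ hpos (ne_zero_of_mem_unit_sphere y)
  have hD : ∀ y : Sph n, DifferentiableAt ℝ (radialLog ρ) (y : E n) := fun y =>
    (hC y).differentiableAt (by simp)
  have hX : ∀ k, ⟪(x : E n), partialDeriv (fun y : Sph n => (y : E n)) x k⟫ = 0 := fun k => by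
    refine Submodule.mem_orthogonal_singleton_iff_inner_right.1 ?_
    rw [← range_diff_coe]
    exact ⟨_, rfl⟩
  rw [intensityBilin_symm (hC x)]
  have hv := hX i
  have hw := hX j
  simp only [intensityForm, Matrix.of_apply]
  obtain ⟨H, hH, hHU⟩ := hasFDerivAt_gradient (hC x)
  have hc : DifferentiableAt ℝ (fun y => 2 * (1 + ‖∇ (radialLog ρ) y‖ ^ 2)⁻¹) (x : E n) := by
    refine ((((hH.differentiableAt).norm_sq ℝ).const_add 1).inv ?_).const_mul 2
    positivity
  have hG := (hasFDerivAt_id (x : E n)).sub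
    (hc.hasFDerivAt.smul ((hasFDerivAt_id (x : E n)).sub hH))
  have hr : partialDeriv (position ρ) x i = _ := diff_position hpos (hD x) (coordVec x i)
  have hγ : partialDeriv (reflectorMap ρ) x j = _ :=
    diff_comp_coe (fun y => reflectorMap_eq hpos (hD y)) hG (coordVec x j)
  rw [hr, hγ]
  change -⟪ρ x • (partialDeriv (fun y : Sph n => (y : E n)) x i + ⟪_,
    partialDeriv (fun y : Sph n => (y : E n)) x i⟫ • (x : E n)),
    (_ : E n →L[ℝ] E n) (partialDeriv (fun y : Sph n => (y : E n)) x j)⟫ / _ = _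
  generalize partialDeriv (fun y : Sph n => (y : E n)) x i = v at hv ⊢
  generalize partialDeriv (fun y : Sph n => (y : E n)) x j = w at hw ⊢
  -- The derivative `c'` of the scalar factor drops out: it multiplies `x - ∇u`, which is normal
  -- to the hypersurface.
  generalize fderiv ℝ (fun y => 2 * (1 + ‖∇ (radialLog ρ) y‖ ^ 2)⁻¹) (x : E n) = c'
  have hgx := inner_coe_gradient (hD x)
  have hHx := fderiv_fderiv_radialLog_self (hC x) w
  rw [← hHU] at hHx
  simp only [intensityBilin, LinearMap.mk₂_apply, ← hHU, ← inner_gradient_left] at hHx ⊢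
  simp only [Pi.sub_apply, id_eq, ContinuousLinearMap.smulRight_apply, _root_.sub_apply,
    _root_.add_apply, _root_.smul_apply, ContinuousLinearMap.id_apply]
  generalize ∇ (radialLog ρ) (x : E n) = g at hgx hHx ⊢
  generalize 2 * (1 + ‖g‖ ^ 2)⁻¹ = c
  have hρx := (hpos x).ne'
  simp only [real_inner_smul_left, inner_add_left, inner_add_right, inner_sub_right,
    real_inner_smul_right, inner_coe_self, hv, hw, real_inner_comm (x : E n) v,
    real_inner_comm (H w) (x : E n), real_inner_comm (H w) v, real_inner_comm g v,
    real_inner_comm g (x : E n), real_inner_comm w v, hgx, hHx]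
  field_simp
  ring

/-! ### The first intensity function -/

/-- The quasilinear equation for `u = log ρ`: `S₁ = n + 2 ((1 - n) |∇u|² - Δu) / (1 + |∇u|²)`. -/
lemma S_one_eq {n : ℕ} {ρ : Sph n → ℝ} (hρ : ContMDiff (𝓡 n) 𝓘(ℝ, ℝ) 2 ρ)
    (hpos : ∀ x, 0 < ρ x) (x : Sph n) :
    S 1 ρ x = n + 2 * (1 + ‖∇ (radialLog ρ) (x : E n)‖ ^ 2)⁻¹ *
      ((1 - n) * ‖∇ (radialLog ρ) (x : E n)‖ ^ 2 - sphereLaplacian (radialLog ρ) x) := by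
  have hC : ContDiffAt ℝ 2 (radialLog ρ) (x : E n) :=
    contDiffAt_radialLog hρ hpos (ne_zero_of_mem_unit_sphere x)
  have hD : DifferentiableAt ℝ (radialLog ρ) (x : E n) := hC.differentiableAt (by simp)
  rw [S_one_eq_sum (intensityBilin ρ x) (intensityBilin_symm hC) (intensityForm_eq hρ hpos x)]
  have hg := sum_inner_tangentFrame_sq x (∇ (radialLog ρ) (x : E n))
  rw [real_inner_comm, inner_coe_gradient hD] at hg
  simp only [real_inner_comm (∇ (radialLog ρ) (x : E n)), inner_gradient_left] at hg
  simp only [intensityBilin, LinearMap.mk₂_apply, inner_tangentFrame, if_true, sphereLaplacian,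
    fderiv_radialLog_self hD, sub_zero, Finset.sum_add_distrib, ← Finset.mul_sum,
    Finset.sum_sub_distrib, Finset.sum_const, Finset.card_univ, Fintype.card_fin, nsmul_eq_mul,
    ← sq, hg]
  have hW : (1 + ‖∇ (radialLog ρ) (x : E n)‖ ^ 2) ≠ 0 := by positivity
  field_simp
  ring

lemma S_one_eq_of_critical {n : ℕ} {ρ : Sph n → ℝ} (hρ : ContMDiff (𝓡 n) 𝓘(ℝ, ℝ) 2 ρ)
    (hpos : ∀ x, 0 < ρ x) {x : Sph n}
    (hx : ∀ i, fderiv ℝ (radialLog ρ) x (tangentFrame x i) = 0) :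
    S 1 ρ x = n - 2 * sphereLaplacian (radialLog ρ) x := by
  have hD : DifferentiableAt ℝ (radialLog ρ) (x : E n) :=
    (contDiffAt_radialLog hρ hpos (ne_zero_of_mem_unit_sphere x)).differentiableAt (by simp)
  have hg := sum_inner_tangentFrame_sq x (∇ (radialLog ρ) (x : E n))
  rw [real_inner_comm, inner_coe_gradient hD] at hg
  simp only [real_inner_comm (∇ (radialLog ρ) (x : E n)), inner_gradient_left, hx] at hg
  rw [S_one_eq hρ hpos, show ‖∇ (radialLog ρ) (x : E n)‖ ^ 2 = 0 by simpa using hg.symm]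
  ring

lemma S_one_le_of_min {n : ℕ} {ρ : Sph n → ℝ} (hρ : ContMDiff (𝓡 n) 𝓘(ℝ, ℝ) 2 ρ)
    (hpos : ∀ x, 0 < ρ x) {x : Sph n} (hx : ∀ y, ρ x ≤ ρ y) : S 1 ρ x ≤ n := by
  obtain ⟨h1, h2⟩ := sphereLaplacian_nonneg_of_min
    (contDiffAt_radialLog hρ hpos (ne_zero_of_mem_unit_sphere x))
    (fun y => by
      rw [radialLog_coe, radialLog_coe]
      exact Real.log_le_log (hpos x) (hx y))
  rw [S_one_eq_of_critical hρ hpos h1]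
  linarith

lemma le_S_one_of_max {n : ℕ} {ρ : Sph n → ℝ} (hρ : ContMDiff (𝓡 n) 𝓘(ℝ, ℝ) 2 ρ)
    (hpos : ∀ x, 0 < ρ x) {x : Sph n} (hx : ∀ y, ρ y ≤ ρ x) : n ≤ S 1 ρ x := by
  have hC := contDiffAt_radialLog hρ hpos (ne_zero_of_mem_unit_sphere x)
  have h0C : ContDiffAt ℝ 2 (0 : E n → ℝ) (x : E n) := contDiffAt_const
  obtain ⟨h1, h2⟩ := sphereLaplacian_nonneg_of_min (F := 0 - radialLog ρ) (h0C.sub hC)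
    (fun y => by
      simp only [Pi.sub_apply, Pi.zero_apply, radialLog_coe, zero_sub, neg_le_neg_iff]
      exact Real.log_le_log (hpos y) (hx y))
  rw [sphereLaplacian_sub h0C hC] at h2
  have h0 : sphereLaplacian (0 : E n → ℝ) x = 0 := by simp [sphereLaplacian]
  rw [h0] at h2
  rw [S_one_eq_of_critical hρ hpos fun i => by simpa [fderiv_neg] using h1 i]
  linarith

/-- If `S₁ ≡ n` then `log ρ` is superharmonic, hence constant. -/
lemma le_of_S_one_eq {n : ℕ} (hn : 1 ≤ n) {ρ : Sph n → ℝ} (hρ : ContMDiff (𝓡 n) 𝓘(ℝ, ℝ) 2 ρ)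
    (hpos : ∀ x, 0 < ρ x) (hS : ∀ x, S 1 ρ x = n) (p y : Sph n) : ρ p ≤ ρ y := by
  rw [← Real.log_le_log_iff (hpos p) (hpos y), ← radialLog_coe, ← radialLog_coe]
  refine le_of_sphereLaplacian_nonpos hn
    (fun x => contDiffAt_radialLog hρ hpos (ne_zero_of_mem_unit_sphere x)) (fun x => ?_) p y
  have h1 := S_one_eq hρ hpos x
  rw [hS] at h1
  have h2 : 0 < 2 * (1 + ‖∇ (radialLog ρ) (x : E n)‖ ^ 2)⁻¹ := by positivity
  have h3 : (1 - n) * ‖∇ (radialLog ρ) (x : E n)‖ ^ 2 - sphereLaplacian (radialLog ρ) x = 0 :=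
    (mul_eq_zero.1 (by linarith)).resolve_left h2.ne'
  have hn' : (1 : ℝ) ≤ n := by exact_mod_cast hn
  nlinarith [sq_nonneg ‖∇ (radialLog ρ) (x : E n)‖]

end Reflector

theorem mainTheorem2 (n : ℕ) (hn : 1 ≤ n) (ρ : Reflector.Sph n → ℝ) (R : Set (Reflector.E n))
    (hR : Reflector.IsRadialGraph ρ R) :
    (∃ x, (n : ℝ) ≤ Reflector.S 1 ρ x) ∧
    (∃ x, Reflector.S 1 ρ x ≤ (n : ℝ)) ∧
    ((∀ x, Reflector.S 1 ρ x = (n : ℝ)) ↔ ∃ c : ℝ, 0 < c ∧ R = Metric.sphere 0 c) := by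
  obtain ⟨hρ, hpos, hRange⟩ := hR
  have : Nonempty (Reflector.Sph n) := (NormedSpace.sphere_nonempty.2 zero_le_one).to_subtype
  obtain ⟨x₀, -, hx₀⟩ := isCompact_univ.exists_isMinOn Set.univ_nonempty hρ.continuous.continuousOn
  obtain ⟨x₁, -, hx₁⟩ := isCompact_univ.exists_isMaxOn Set.univ_nonempty hρ.continuous.continuousOn
  refine ⟨⟨x₁, Reflector.le_S_one_of_max hρ hpos fun y => hx₁ (Set.mem_univ y)⟩,
    ⟨x₀, Reflector.S_one_le_of_min hρ hpos fun y => hx₀ (Set.mem_univ y)⟩, fun hS => ?_, ?_⟩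
  · have hconst : ∀ y, ρ y = ρ x₀ := fun y =>
      le_antisymm (Reflector.le_of_S_one_eq hn hρ hpos hS y x₀)
        (Reflector.le_of_S_one_eq hn hρ hpos hS x₀ y)
    refine ⟨ρ x₀, hpos x₀, ?_⟩
    rw [hRange]
    ext z
    simp only [Set.mem_range, Reflector.position, hconst, mem_sphere_zero_iff_norm]
    constructor
    · rintro ⟨x, rfl⟩
      rw [norm_smul, Reflector.norm_coe_sphere, mul_one, Real.norm_of_nonneg (hpos x₀).le]
    · intro hz
      refine ⟨⟨(ρ x₀)⁻¹ • z, ?_⟩, ?_⟩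
      · rw [mem_sphere_zero_iff_norm, norm_smul, hz, norm_inv, Real.norm_of_nonneg (hpos x₀).le,
          inv_mul_cancel₀ (hpos x₀).ne']
      · rw [smul_smul, mul_inv_cancel₀ (hpos x₀).ne', one_smul]
  · rintro ⟨c, -, hc⟩ x
    have hconst : ∀ y, ρ y = c := fun y => by
      have hy : Reflector.position ρ y ∈ Metric.sphere (0 : Reflector.E n) c := by
        rw [← hc, hRange]
        exact ⟨y, rfl⟩
      rwa [mem_sphere_zero_iff_norm, Reflector.position, norm_smul, Reflector.norm_coe_sphere,
        mul_one, Real.norm_of_nonneg (hpos y).le] at hy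
    -- Every point is both a minimum and a maximum of a constant radial function.
    exact le_antisymm
      (Reflector.S_one_le_of_min hρ hpos fun y => by rw [hconst, hconst])
      (Reflector.le_S_one_of_max hρ hpos fun y => by rw [hconst, hconst])
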